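/- Let $n,r$ be positive integers. There are constants $d\in\mathbb N$ and $C\in\mathbb R$, depending only on $n$ and $r$, such that the following holds for every closed cube $Q\subset\mathbb R^n$ of positive side length with sides parallel to the axes, and all functions $f_1,\dots,f_r:Q\to\mathbb R$. *Objects attached to $f_1,\dots,f_r$.* For a family $(H_x)_{x\in Q}$ of linear subspaces of $\mathbb R^r$, its Glaeser refinement is the family with fiber $\{v\in H_x:\operatorname{dist}(v,H_y)\to0\text{ as }y\to x,\ y\in Q\}$ at $x$. Put $H^0_x=\{v\in\mathbb R^r:\sum_i v_if_i(x)=0\}$ and let $(H^{\ell}_x)_{x\in Q}$ be the $\ell$-th iterated Glaeser refinement of $(H^0_x)_{x\in Q}$. Let $\widetilde\xi_i(x)=0$ if $f_1(x)=\dots=f_r(x)=0$, and $\widetilde\xi_i(x)=f_i(x)/\sum_jf_j(x)^2$ otherwise. Call *admissible limit data* for $f_1,\dots,f_r$ a choice, for $1\le\ell\le 2r+1$, $\nu\ge1$, $1\le i,j\le r$, $x\in Q$, of vectors $\widetilde\lambda^{\ell}_i(x),\lambda^{\ell,\nu}_i(x),w_i(x)\in\mathbb R^r$, points $y^{\ell,\nu}_i(x)\in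 Q$ and coefficients $\beta^{\ell,\nu}_{ij}(x)\in\mathbb R$ such that, with $s=\dim (H^{\ell}_x)^\perp$ and with $\widetilde\lambda^0_i(x)$ the $i$-th standard basis vector: (a) $\widetilde\lambda^{\ell}_1(x),\dots,\widetilde\lambda^{\ell}_r(x)$ is a basis of $\mathbb R^r$, with $\widetilde\lambda^\ell_i(x)\in(H^{\ell}_x)^\perp$ for $i\le s$ and $\widetilde\lambda^\ell_i(x)\in H^{\ell}_x$ for $i>s$; (b) $y^{\ell,\nu}_i(x)\to x$ as $\nu\to\infty$ and $\lambda^{\ell,\nu}_i(x)\perp H^{\ell-1}_{y}$ at $y=y^{\ell,\nu}_i(x)$; if $i\le s$, then $\lambda^{\ell,\nu}_i(x)\to\widetilde\lambda^\ell_i(x)$ as $\nu\to\infty$; if $i>s$, then $y^{\ell,\nu}_i(x)=x$ and $\lambda^{\ell,\nu}_i(x)=0$ for all $\nu$; (c) $\lambda^{\ell,\nu}_i(x)=\sum_{j=1}^r\beta^{\ell,\nu}_{ij}(x)\,\widetilde\lambda^{\ell-1}_j\bigl(y^{\ell,\nu}_i(x)\bigr)$; (d) $v=\sum_{i=1}^r\bigl(\widetilde\lambda^{2r+1}_i(x)\cdot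 v\bigr)\,w_i(x)$ for all $v\in\mathbb R^r$. *Procedure.* Given admissible limit data, finite sets $S(x)\subset Q$ and linear maps $A(x,y):\mathbb R^r\to\mathbb R^r$, let $A_{ij}(x,y)$ be the $i$-th component of $A(x,y)w_j(y)$. For a function $\phi:Q\to\mathbb R$ compute, for all $x\in Q$ and $1\le i\le r$, $$\xi^0_i(x)=\widetilde\xi_i(x)\,\phi(x),\qquad \xi^\ell_i(x)=\lim_{\nu\to\infty}\sum_{j=1}^r\beta^{\ell,\nu}_{ij}(x)\,\xi^{\ell-1}_j\bigl(y^{\ell,\nu}_i(x)\bigr)\quad(1\le\ell\le2r+1),$$ $$\Phi_i(x)=\sum_{y\in S(x)}\sum_{j=1}^rA_{ij}(x,y)\,\xi^{2r+1}_j(y).$$ The procedure succeeds if all these limits exist. *Claim.* Admissible limit data for $f_1,\dots,f_r$ exist. Moreover, there are finite sets $S(x)\subset Q$ $(x\in Q)$ with at most $d$ points each, and linear maps $A(x,y):\mathbb R^r\to\mathbb R^r$, depending only on $f_1,\dots,f_r$, with the following property. For every choice of admissible limit data for $f_1,\dots,f_r$, every function $\phi:Q\to\mathbb R$, and all continuous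 $\phi_1,\dots,\phi_r:Q\to\mathbb R$ with $\phi_1f_1+\dots+\phi_rf_r=\phi$ on $Q$, the procedure succeeds, the resulting functions $\Phi_1,\dots,\Phi_r$ are continuous, $\Phi_1f_1+\dots+\Phi_rf_r=\phi$ on $Q$, and $$\max_{x\in Q,\,1\le i\le r}|\Phi_i(x)|\le C\max_{x\in Q,\,1\le i\le r}|\phi_i(x)|.$$ -/

import Mathlib

open Filter Topology

namespace GlaeserProcedure

/-- `ℝ^r` with its standard inner product. -/
abbrev Vec (r : ℕ) : Type := EuclideanSpace ℝ (Fin r)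

/-- The closed cube in `ℝ^n` with sides parallel to the axes, lowest corner `a`
and side length `δ`. -/
def closedCube {n : ℕ} (a : EuclideanSpace ℝ (Fin n)) (δ : ℝ) :
    Set (EuclideanSpace ℝ (Fin n)) :=
  {x | ∀ k, a k ≤ x k ∧ x k ≤ a k + δ}

section Bundles

variable {X : Type*} [TopologicalSpace X] {r : ℕ}

/-- The Glaeser refinement of a homogeneous bundle `(H_x)`: its fiber at `x` consists of the
`v ∈ H_x` with `dist (v, H_y) → 0` as `y → x`. -/
def glaeser (H : X → Submodule ℝ (Vec r)) (x : X) : Submodule ℝ (Vec r) where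
  carrier := {v | v ∈ H x ∧
    Tendsto (fun y => Metric.infDist v (H y : Set (Vec r))) (𝓝 x) (𝓝 0)}
  zero_mem' := by
    refine ⟨(H x).zero_mem, ?_⟩
    have h : (fun y => Metric.infDist (0 : Vec r) (H y : Set (Vec r))) = fun _ => 0 := by
      funext y
      exact Metric.infDist_zero_of_mem (H y).zero_mem
    rw [h]
    exact tendsto_const_nhds
  add_mem' := by
    rintro u v ⟨hu, hu'⟩ ⟨hv, hv'⟩
    refine ⟨(H x).add_mem hu hv, ?_⟩
    refine squeeze_zero (fun _ => Metric.infDist_nonneg) (fun y => ?_)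
      (by simpa using hu'.add hv')
    refine le_of_forall_pos_lt_add fun ε hε => ?_
    have hne : (H y : Set (Vec r)).Nonempty := ⟨0, (H y).zero_mem⟩
    obtain ⟨p, hp, hp'⟩ := (Metric.infDist_lt_iff hne).1
      (lt_add_of_pos_right (Metric.infDist u (H y : Set (Vec r))) (half_pos hε))
    obtain ⟨q, hq, hq'⟩ := (Metric.infDist_lt_iff hne).1
      (lt_add_of_pos_right (Metric.infDist v (H y : Set (Vec r))) (half_pos hε))
    have h1 := Metric.infDist_le_dist_of_mem (x := u + v) ((H y).add_mem hp hq)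
    have h2 := dist_add_add_le u v p q
    linarith
  smul_mem' := by
    rintro c v ⟨hv, hv'⟩
    refine ⟨(H x).smul_mem c hv, ?_⟩
    refine squeeze_zero (fun _ => Metric.infDist_nonneg) (fun y => ?_)
      (by simpa using hv'.const_mul (|c| + 1))
    have hne : (H y : Set (Vec r)).Nonempty := ⟨0, (H y).zero_mem⟩
    have hc : 0 < |c| + 1 := by positivity
    rw [← div_le_iff₀' hc]
    refine (Metric.le_infDist hne).2 fun p hp => ?_
    rw [div_le_iff₀' hc]
    have h1 := Metric.infDist_le_dist_of_mem (x := c • v) ((H y).smul_mem c hp)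
    have h2 : dist (c • v) (c • p) = |c| * dist v p := dist_smul₀ c v p
    have h3 : (0 : ℝ) ≤ dist v p := dist_nonneg
    linarith

/-- The `ℓ`-th iterated Glaeser refinement. -/
def glaeserIter (H : X → Submodule ℝ (Vec r)) (ℓ : ℕ) : X → Submodule ℝ (Vec r) :=
  glaeser^[ℓ] H

end Bundles

section Procedure

variable {X : Type*} {r : ℕ}

/-- The homogeneous bundle `H⁰_x = {v : v_1 f_1(x) + ⋯ + v_r f_r(x) = 0}`. -/
def kernelBundle (f : Fin r → X → ℝ) (x : X) : Submodule ℝ (Vec r) where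
  carrier := {v | ∑ i, v i * f i x = 0}
  zero_mem' := by simp
  add_mem' := by
    intro u v hu hv
    simp only [Set.mem_ofPred_eq] at hu hv ⊢
    simp [add_mul, Finset.sum_add_distrib, hu, hv]
  smul_mem' := by
    intro c v hv
    simp only [Set.mem_ofPred_eq] at hv ⊢
    simp [mul_assoc, ← Finset.mul_sum, hv]

/-- The objects from which the iterated limits are formed. The first argument of
`lam`, `lamSeq`, `y`, `β` is the level `ℓ`; the second one of `lamSeq`, `y`, `β` is the
sequence index `ν`. Only the values of `lam` with `ℓ ≤ 2r+1`, and those of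
`lamSeq`, `y`, `β` with `1 ≤ ℓ ≤ 2r+1`, are relevant. -/
structure LimitData (X : Type*) (r : ℕ) where
  lam : ℕ → X → Fin r → Vec r
  lamSeq : ℕ → ℕ → X → Fin r → Vec r
  y : ℕ → ℕ → X → Fin r → X
  β : ℕ → ℕ → X → Fin r → Fin r → ℝ
  w : X → Fin r → Vec r

open scoped InnerProductSpace in
/-- The objects in `D` arise from the homogeneous bundle `H` by the construction of the
iterated Glaeser refinements `H^ℓ`. Write `s = dim (H^{ℓ+1}_x)^⊥`. The vectors
`lam (ℓ+1) x i` form a basis of `ℝ^r`, the first `s` of them lying in `(H^{ℓ+1}_x)^⊥` and the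
remaining ones in `H^{ℓ+1}_x`; each of the first `s` is a limit of vectors orthogonal to the
fibers of `H^ℓ` at points tending to `x`. -/
structure LimitData.IsAdmissible [TopologicalSpace X] (D : LimitData X r)
    (H : X → Submodule ℝ (Vec r)) : Prop where
  lam_zero : ∀ x i, D.lam 0 x i = EuclideanSpace.single i 1
  lam_basis : ∀ ℓ < 2 * r + 1, ∀ x, LinearIndependent ℝ (D.lam (ℓ + 1) x)
  lam_mem_orthogonal : ∀ ℓ < 2 * r + 1, ∀ (x : X) (i : Fin r),
    (i : ℕ) < Module.finrank ℝ (glaeserIter H (ℓ + 1) x)ᗮ →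
      D.lam (ℓ + 1) x i ∈ (glaeserIter H (ℓ + 1) x)ᗮ
  lam_mem : ∀ ℓ < 2 * r + 1, ∀ (x : X) (i : Fin r),
    Module.finrank ℝ (glaeserIter H (ℓ + 1) x)ᗮ ≤ (i : ℕ) →
      D.lam (ℓ + 1) x i ∈ glaeserIter H (ℓ + 1) x
  y_tendsto : ∀ ℓ < 2 * r + 1, ∀ (x : X) (i : Fin r),
    Tendsto (fun ν => D.y (ℓ + 1) ν x i) atTop (𝓝 x)
  lamSeq_tendsto : ∀ ℓ < 2 * r + 1, ∀ (x : X) (i : Fin r),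
    (i : ℕ) < Module.finrank ℝ (glaeserIter H (ℓ + 1) x)ᗮ →
      Tendsto (fun ν => D.lamSeq (ℓ + 1) ν x i) atTop (𝓝 (D.lam (ℓ + 1) x i))
  lamSeq_orthogonal : ∀ ℓ < 2 * r + 1, ∀ (ν : ℕ) (x : X) (i : Fin r),
    D.lamSeq (ℓ + 1) ν x i ∈ (glaeserIter H ℓ (D.y (ℓ + 1) ν x i))ᗮ
  y_eq : ∀ ℓ < 2 * r + 1, ∀ (ν : ℕ) (x : X) (i : Fin r),
    Module.finrank ℝ (glaeserIter H (ℓ + 1) x)ᗮ ≤ (i : ℕ) → D.y (ℓ + 1) ν x i = x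
  lamSeq_eq : ∀ ℓ < 2 * r + 1, ∀ (ν : ℕ) (x : X) (i : Fin r),
    Module.finrank ℝ (glaeserIter H (ℓ + 1) x)ᗮ ≤ (i : ℕ) → D.lamSeq (ℓ + 1) ν x i = 0
  lamSeq_expand : ∀ ℓ < 2 * r + 1, ∀ (ν : ℕ) (x : X) (i : Fin r),
    D.lamSeq (ℓ + 1) ν x i =
      ∑ j, D.β (ℓ + 1) ν x i j • D.lam ℓ (D.y (ℓ + 1) ν x i) j
  w_dual : ∀ (x : X) (v : Vec r), v = ∑ i, ⟪D.lam (2 * r + 1) x i, v⟫_ℝ • D.w x i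

open Classical in
/-- `ξ̃_i(x)`: zero at the common zeros of the `f_j`, and `f_i / ∑ f_j²` elsewhere. -/
noncomputable def xiTilde (f : Fin r → X → ℝ) (x : X) (i : Fin r) : ℝ :=
  if ∀ j, f j x = 0 then 0 else f i x / ∑ j, f j x ^ 2

/-- The recursion for `ξ^ℓ_i(x)`. The value of `limUnder` is meaningful only if the limit
exists, which is what `Succeeds` requires. -/
noncomputable def xi (f : Fin r → X → ℝ) (D : LimitData X r) (φ : X → ℝ) :
    ℕ → X → Fin r → ℝ
  | 0 => fun x i => xiTilde f x i * φ x
  | ℓ + 1 => fun x i =>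
      limUnder atTop fun ν : ℕ =>
        ∑ j, D.β (ℓ + 1) ν x i j * xi f D φ ℓ (D.y (ℓ + 1) ν x i) j

/-- All limits in the recursion exist, up to level `2r+1`. -/
def Succeeds (f : Fin r → X → ℝ) (D : LimitData X r) (φ : X → ℝ) : Prop :=
  ∀ ℓ < 2 * r + 1, ∀ (x : X) (i : Fin r), ∃ L : ℝ,
    Tendsto (fun ν : ℕ =>
      ∑ j, D.β (ℓ + 1) ν x i j * xi f D φ ℓ (D.y (ℓ + 1) ν x i) j) atTop (𝓝 L)

/-- `A_{ij}(x,y)`: the `i`-th component of the vector `A(x,y) w_j(y)`. -/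
def coeff (D : LimitData X r) (A : X → X → Vec r →ₗ[ℝ] Vec r) (i j : Fin r) (x y : X) : ℝ :=
  A x y (D.w y j) i

/-- The output `Φ_i(x) = ∑_{y ∈ S(x)} ∑_j A_{ij}(x,y) ξ^{2r+1}_j(y)` of the procedure. -/
noncomputable def output (f : Fin r → X → ℝ) (D : LimitData X r) (S : X → Finset X)
    (A : X → X → Vec r →ₗ[ℝ] Vec r) (φ : X → ℝ) (i : Fin r) (x : X) : ℝ :=
  ∑ y ∈ S x, ∑ j, coeff D A i j x y * xi f D φ (2 * r + 1) y j

end Procedure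

end GlaeserProcedure

namespace GlaeserProcedure

open scoped InnerProductSpace

/-! ### Glaeser refinement, its stabilization, and continuity of fiber projections -/

section Bundles

variable {r : ℕ}

/-! Let `F` be the vector of a continuous solution and `H` the bundle `H^(2r+1)`. The iterated
limits recover exactly the part of `F` that `φ` determines, `g = F - (projection of F on H)`. By
induction on the level, a combination of the `ξ^ℓ_j(y)` equals the inner product of `F y` with the
same combination of the `λ^ℓ_j(y)`, whenever the latter is normal to the fiber; continuity of `F`
carries this to the next level (`sum_mul_xi_eq_inner`, `sum_xi_smul_w`).

Fiber dimension is lower semicontinuous under refinement, which makes `H` Glaeser stable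
(`glaeser_glaeserIter_eq`). It remains to build, linearly in `g` and with bounded depth, a
continuous section of the affine bundle `g + H` (`exists_selection_finrank_lt`). This goes by
induction on fiber dimension: extend the section from the closed set of smaller fibers by a Whitney
type operator, then project the extension onto the affine fibers. Stability gives continuity across
strata. This operator depends only on `H`, not on the limit data.

Limit data exist because the normals to a refined fiber are spanned by limits of normals to nearby
fibers (`span_limits_eq_glaeser_orthogonal`). -/

theorem infDist_eq_norm_sub_starProjection (K : Submodule ℝ (Vec r)) (v : Vec r) :
    Metric.infDist v (K : Set (Vec r)) = ‖v - K.starProjection v‖ := by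
  rw [Submodule.starProjection_minimal, Metric.infDist_eq_iInf]
  simp only [dist_eq_norm]
  rfl

theorem norm_sub_starProjection_le (K : Submodule ℝ (Vec r)) (v : Vec r) {p : Vec r}
    (hp : p ∈ K) : ‖v - K.starProjection v‖ ≤ ‖v - p‖ := by
  rw [← infDist_eq_norm_sub_starProjection, ← dist_eq_norm]
  exact Metric.infDist_le_dist_of_mem hp

variable {X : Type*} [TopologicalSpace X] {H H' : X → Submodule ℝ (Vec r)} {x : X}

theorem mem_glaeser {v : Vec r} : v ∈ glaeser H x ↔ v ∈ H x ∧
    Tendsto (fun y => Metric.infDist v (H y : Set (Vec r))) (𝓝 x) (𝓝 0) := Iff.rfl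

theorem glaeser_le (H : X → Submodule ℝ (Vec r)) (x : X) : glaeser H x ≤ H x := fun _ hv => hv.1

theorem tendsto_starProjection_of_mem_glaeser {v : Vec r} (hv : v ∈ glaeser H x) :
    Tendsto (fun y => (H y).starProjection v) (𝓝 x) (𝓝 v) := by
  rw [tendsto_iff_norm_sub_tendsto_zero]
  refine hv.2.congr fun y => ?_
  rw [infDist_eq_norm_sub_starProjection, norm_sub_rev]

/-- Projecting a basis of the refined fiber to `H y` moves it little, and linear independence is an
open condition. -/
theorem finrank_glaeser_le_eventually (H : X → Submodule ℝ (Vec r)) (x : X) :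
    ∀ᶠ y in 𝓝 x, Module.finrank ℝ (glaeser H x) ≤ Module.finrank ℝ (H y) := by
  let b := Module.finBasis ℝ (glaeser H x)
  have hb : LinearIndependent ℝ fun i => (b i : Vec r) :=
    b.linearIndependent.map' (glaeser H x).subtype (Submodule.ker_subtype _)
  have hT : Tendsto (fun y i => (H y).starProjection (b i : Vec r)) (𝓝 x)
      (𝓝 fun i => (b i : Vec r)) :=
    tendsto_pi_nhds.2 fun i => tendsto_starProjection_of_mem_glaeser (b i).2
  filter_upwards [hT (isOpen_setOfPred_linearIndependent.mem_nhds hb)] with y hy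
  have hy' : LinearIndependent ℝ fun i =>
      (⟨(H y).starProjection (b i : Vec r), (H y).starProjection_apply_mem _⟩ : H y) :=
    LinearIndependent.of_comp (H y).subtype hy
  simpa using hy'.fintype_card_le_finrank

theorem glaeser_eq_of_eventuallyEq (h : H =ᶠ[𝓝 x] H') : glaeser H x = glaeser H' x := by
  ext v
  rw [mem_glaeser, mem_glaeser, h.eq_of_nhds]
  refine and_congr_right fun _ => tendsto_congr' ?_
  filter_upwards [h] with y hy
  rw [hy]

theorem glaeser_eventuallyEq (h : H =ᶠ[𝓝 x] H') : glaeser H =ᶠ[𝓝 x] glaeser H' :=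
  (eventually_eventually_nhds.2 h).mono fun _ hy => glaeser_eq_of_eventuallyEq hy

theorem glaeserIter_succ (H : X → Submodule ℝ (Vec r)) (ℓ : ℕ) :
    glaeserIter H (ℓ + 1) = glaeser (glaeserIter H ℓ) :=
  Function.iterate_succ_apply' _ _ _

theorem glaeserIter_antitone (H : X → Submodule ℝ (Vec r)) (x : X) :
    Antitone fun ℓ => glaeserIter H ℓ x :=
  antitone_nat_of_succ_le fun ℓ => by
    rw [glaeserIter_succ]
    exact glaeser_le _ _

theorem glaeserIter_eventuallyEq_of_succ {m : ℕ}
    (h : glaeserIter H (m + 1) =ᶠ[𝓝 x] glaeserIter H m) {ℓ : ℕ} (hℓ : m ≤ ℓ) :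
    glaeserIter H ℓ =ᶠ[𝓝 x] glaeserIter H m := by
  induction ℓ, hℓ using Nat.le_induction with
  | base => exact EventuallyEq.rfl
  | succ ℓ _ ih =>
    rw [glaeserIter_succ]
    refine (glaeser_eventuallyEq ih).trans ?_
    rwa [← glaeserIter_succ]

/-- Induction on codimension. Each codimension costs two refinements: semicontinuity consumes one,
and the other makes two consecutive bundles agree on a neighborhood, after which nothing changes
there. -/
theorem glaeserIter_eq_of_finrank_ge (H : X → Submodule ℝ (Vec r)) (k : ℕ) :
    ∀ x, r ≤ Module.finrank ℝ (glaeserIter H (2 * k + 1) x) + k →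
      ∀ ℓ, 2 * k + 1 ≤ ℓ → glaeserIter H ℓ x = glaeserIter H (2 * k + 1) x := by
  induction k with
  | zero =>
    intro x hx ℓ hℓ
    have hev : ∀ᶠ y in 𝓝 x, glaeserIter H 0 y = ⊤ := by
      have h := finrank_glaeser_le_eventually (glaeserIter H 0) x
      rw [← glaeserIter_succ] at h
      filter_upwards [h] with y hy
      refine Submodule.eq_top_of_finrank_eq (le_antisymm (Submodule.finrank_le _) ?_)
      rw [finrank_euclideanSpace_fin]
      exact le_trans hx hy
    have hsucc : glaeserIter H (0 + 1) =ᶠ[𝓝 x] glaeserIter H 0 := by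
      filter_upwards [eventually_eventually_nhds.2 hev] with y hy
      rw [hy.self_of_nhds, glaeserIter_succ, eq_top_iff]
      intro v _
      rw [mem_glaeser, hy.self_of_nhds]
      refine ⟨trivial, tendsto_const_nhds.congr' ?_⟩
      filter_upwards [hy] with z hz
      rw [hz]
      exact (Metric.infDist_zero_of_mem (Set.mem_univ v)).symm
    rw [(glaeserIter_eventuallyEq_of_succ hsucc (Nat.zero_le ℓ)).eq_of_nhds,
      (glaeserIter_eventuallyEq_of_succ hsucc (Nat.zero_le (2 * 0 + 1))).eq_of_nhds]
  | succ k ih =>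
    intro x hx ℓ hℓ
    by_cases hk : r ≤ Module.finrank ℝ (glaeserIter H (2 * k + 1) x) + k
    · rw [ih x hk ℓ (by lia), ih x hk (2 * (k + 1) + 1) (by lia)]
    · have hlsc := finrank_glaeser_le_eventually (glaeserIter H (2 * k + 2)) x
      rw [← glaeserIter_succ] at hlsc
      have hsucc : glaeserIter H (2 * k + 1 + 1) =ᶠ[𝓝 x] glaeserIter H (2 * k + 1) := by
        filter_upwards [hlsc] with y hy
        -- Nearby fibers of larger dimension are already stable by induction; the others have
        -- dimension at most `r - k - 1`, which semicontinuity also makes a lower bound one level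
        -- later.
        by_cases hyk : r ≤ Module.finrank ℝ (glaeserIter H (2 * k + 1) y) + k
        · exact ih y hyk _ (by lia)
        · have hle : Module.finrank ℝ (glaeserIter H (2 * k + 1) y) ≤
              Module.finrank ℝ (glaeserIter H (2 * k + 2) y) := by
            have hx' : r ≤ Module.finrank ℝ (glaeserIter H (2 * k + 2 + 1) x) + (k + 1) := hx
            exact Nat.le_of_add_le_add_right (b := k + 1)
              ((Nat.succ_le_of_lt (not_le.1 hyk)).trans (hx'.trans (Nat.add_le_add_right hy _)))
          exact Submodule.eq_of_le_of_finrank_le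
            (glaeserIter_antitone H y (Nat.le_succ (2 * k + 1))) hle
      rw [(glaeserIter_eventuallyEq_of_succ hsucc (ℓ := ℓ) (by lia)).eq_of_nhds,
        (glaeserIter_eventuallyEq_of_succ hsucc (ℓ := 2 * (k + 1) + 1) (by lia)).eq_of_nhds]

/-- The iterated Glaeser refinements of a bundle in `ℝ^r` stabilize after `2r+1` steps. -/
theorem glaeser_glaeserIter_eq (H : X → Submodule ℝ (Vec r)) :
    glaeser (glaeserIter H (2 * r + 1)) = glaeserIter H (2 * r + 1) := by
  rw [← glaeserIter_succ]
  funext x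
  exact glaeserIter_eq_of_finrank_ge H r x (Nat.le_add_left _ _) _ (Nat.le_succ _)

/-- On a set where the fibers of a Glaeser stable bundle have the same dimension, the orthogonal
projections onto the fibers vary continuously. -/
theorem tendsto_starProjection_of_finrank_eq (hH : glaeser H = H) {s : Set X}
    (hs : ∀ y ∈ s, Module.finrank ℝ (H y) = Module.finrank ℝ (H x)) (u : Vec r) :
    Tendsto (fun y => (H y).starProjection u) (𝓝[s] x) (𝓝 ((H x).starProjection u)) := by
  have hball : ∀ y, (H y).starProjection u ∈ Metric.closedBall (0 : Vec r) ‖u‖ := fun y => by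
    rw [mem_closedBall_zero_iff]
    exact (H y).norm_starProjection_apply_le u
  refine (isCompact_closedBall (0 : Vec r) ‖u‖).tendsto_nhds_of_unique_mapClusterPt
    (Eventually.of_forall hball) fun w _ hw => ?_
  obtain ⟨U, hU, hUw⟩ := mapClusterPt_iff_ultrafilter.1 hw
  have hconv : ∀ v ∈ H x, Tendsto (fun y => (H y).starProjection v) U (𝓝 v) := fun v hv =>
    (tendsto_starProjection_of_mem_glaeser (by rwa [hH])).mono_left (hU.trans nhdsWithin_le_nhds)
  have hUs : ∀ᶠ y in (U : Filter X), y ∈ s := hU self_mem_nhdsWithin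
  refine (Submodule.eq_starProjection_of_mem_of_inner_eq_zero (K := H x) ?_ fun v hv => ?_).symm
  -- A cluster point outside `H x` would, with a basis of `H x`, be a limit of `dim + 1` vectors of
  -- `H y`, hence force independent vectors beyond the common dimension.
  · by_contra hwx
    let b := Module.finBasis ℝ (H x)
    have hb : LinearIndependent ℝ fun i => (b i : Vec r) :=
      b.linearIndependent.map' (H x).subtype (Submodule.ker_subtype _)
    have hbw : LinearIndependent ℝ (Fin.cons w fun i => (b i : Vec r) : Fin _ → Vec r) := by
      refine hb.finCons fun hmem => hwx ?_
      refine Submodule.span_le.2 ?_ hmem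
      rintro _ ⟨i, rfl⟩
      exact (b i).2
    have hT : Tendsto (fun y => (Fin.cons ((H y).starProjection u)
        fun i => (H y).starProjection (b i : Vec r) : Fin _ → Vec r)) U
        (𝓝 (Fin.cons w fun i => (b i : Vec r))) := by
      refine tendsto_pi_nhds.2 fun i => ?_
      refine Fin.cases ?_ (fun j => ?_) i
      · simpa using hUw
      · simpa using hconv _ (b j).2
    obtain ⟨y, hy, hys⟩ :=
      ((hT.eventually (isOpen_setOfPred_linearIndependent.mem_nhds hbw)).and hUs).exists
    have hle : Set.range (Fin.cons ((H y).starProjection u)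
        fun i => (H y).starProjection (b i : Vec r) : Fin _ → Vec r) ⊆ H y := by
      rintro _ ⟨i, rfl⟩
      refine Fin.cases ?_ (fun j => ?_) i
      · exact (H y).starProjection_apply_mem _
      · exact (H y).starProjection_apply_mem _
    have hcard := (finrank_span_eq_card hy).symm.trans_le
      (Submodule.finrank_mono (Submodule.span_le.2 hle))
    rw [Fintype.card_fin, hs y hys] at hcard
    lia
  · have h1 : Tendsto (fun y => ⟪u - (H y).starProjection u, (H y).starProjection v⟫_ℝ) U
        (𝓝 ⟪u - w, v⟫_ℝ) := (tendsto_const_nhds.sub hUw).inner (hconv v hv)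
    refine tendsto_nhds_unique h1 (tendsto_const_nhds.congr fun y => ?_)
    exact (Submodule.starProjection_inner_eq_zero _ _ ((H y).starProjection_apply_mem _)).symm

end Bundles

/-! ### Operators of bounded depth -/

section Depth

variable {X V : Type*} [AddCommGroup V] [Module ℝ V]

/-- `L` depends linearly on the values of its argument at no more than `d` points. -/
def HasDepth (d : ℕ) (L : (X → V) → V) : Prop :=
  ∃ S : Finset X, S.card ≤ d ∧ ∃ A : X → V →ₗ[ℝ] V, ∀ g, L g = ∑ y ∈ S, A y (g y)

theorem hasDepth_zero (d : ℕ) : HasDepth d fun _ : X → V => (0 : V) :=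
  ⟨∅, by simp, 0, by simp⟩

theorem HasDepth.mono {d d' : ℕ} {L : (X → V) → V} (h : HasDepth d L) (hd : d ≤ d') :
    HasDepth d' L := by
  obtain ⟨S, hS, A, hA⟩ := h
  exact ⟨S, hS.trans hd, A, hA⟩

theorem hasDepth_eval (x : X) : HasDepth 1 fun g : X → V => g x :=
  ⟨{x}, by simp, fun _ => LinearMap.id, by simp⟩

theorem HasDepth.map {d : ℕ} {L : (X → V) → V} (h : HasDepth d L) (B : V →ₗ[ℝ] V) :
    HasDepth d fun g => B (L g) := by
  obtain ⟨S, hS, A, hA⟩ := h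
  exact ⟨S, hS, fun y => B ∘ₗ A y, fun g => by simp [hA]⟩

theorem HasDepth.add {d d' : ℕ} {L L' : (X → V) → V} (h : HasDepth d L) (h' : HasDepth d' L') :
    HasDepth (d + d') fun g => L g + L' g := by
  classical
  obtain ⟨S, hS, A, hA⟩ := h
  obtain ⟨S', hS', A', hA'⟩ := h'
  refine ⟨S ∪ S', (Finset.card_union_le _ _).trans (add_le_add hS hS'),
    fun y => (if y ∈ S then A y else 0) + if y ∈ S' then A' y else 0, fun g => ?_⟩
  have e : ∀ (B : X → V →ₗ[ℝ] V) (R : Finset X), R ⊆ S ∪ S' →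
      ∑ y ∈ S ∪ S', (if y ∈ R then B y else 0) (g y) = ∑ y ∈ R, B y (g y) := by
    intro B R hR
    rw [← Finset.sum_subset hR fun y _ hy => by simp [hy]]
    exact Finset.sum_congr rfl fun y hy => by simp [hy]
  simp only [LinearMap.add_apply, Finset.sum_add_distrib]
  rw [hA, hA', e A S Finset.subset_union_left, e A' S' Finset.subset_union_right]

theorem HasDepth.sum {ι : Type*} {d : ℕ} (s : Finset ι) {L : ι → (X → V) → V}
    (h : ∀ i ∈ s, HasDepth d (L i)) : HasDepth (s.card * d) fun g => ∑ i ∈ s, L i g := by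
  classical
  induction s using Finset.induction_on with
  | empty => simpa using hasDepth_zero _
  | insert i s hi ih =>
    simp only [Finset.sum_insert hi, Finset.card_insert_of_notMem hi]
    rw [add_mul, one_mul, add_comm]
    exact (h i (Finset.mem_insert_self _ _)).add
      (ih fun j hj => h j (Finset.mem_insert_of_mem hj))

theorem HasDepth.comp {d N : ℕ} {L : (X → V) → V} (hL : HasDepth N L)
    {T : (X → V) → X → V} (hT : ∀ x, HasDepth d fun g => T g x) :
    HasDepth (N * d) fun g => L (T g) := by
  obtain ⟨S, hS, A, hA⟩ := hL
  simp only [hA]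
  exact (HasDepth.sum S fun y _ => (hT y).map (A y)).mono (Nat.mul_le_mul_right d hS)

end Depth

/-! ### Whitney type partition of unity and linear extension -/

section Extension

/-- The tent function with support `[-1, 1]`. -/
noncomputable def tent (t : ℝ) : ℝ := max 0 (1 - |t|)

theorem tent_nonneg (t : ℝ) : 0 ≤ tent t := le_max_left _ _

theorem continuous_tent : Continuous tent := by
  unfold tent
  fun_prop

theorem tent_sub_eq_zero {t : ℝ} {k : ℤ} (hk : k ∉ ({⌊t⌋, ⌊t⌋ + 1} : Finset ℤ)) :
    tent (t - k) = 0 := by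
  simp only [Finset.mem_insert, Finset.mem_singleton, not_or] at hk
  refine max_eq_left (sub_nonpos.2 ?_)
  rcases lt_or_gt_of_ne hk.1 with h | h
  · have h1 : (k : ℝ) + 1 ≤ ⌊t⌋ := by exact_mod_cast h
    have h2 := Int.floor_le t
    exact le_trans (by linarith) (le_abs_self _)
  · have h1 : (⌊t⌋ : ℝ) + 1 + 1 ≤ k := by
      exact_mod_cast lt_of_le_of_ne (Int.add_one_le_of_lt h) (Ne.symm hk.2)
    have h2 := Int.lt_floor_add_one t
    exact le_trans (by linarith) (neg_le_abs _)

theorem sum_tent_sub (t : ℝ) : ∑ k ∈ ({⌊t⌋, ⌊t⌋ + 1} : Finset ℤ), tent (t - k) = 1 := by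
  rw [Finset.sum_pair (by lia)]
  have h1 := Int.floor_le t
  have h2 := Int.lt_floor_add_one t
  push_cast
  unfold tent
  rw [abs_of_nonneg (by linarith), abs_of_nonpos (by linarith), max_eq_right (by linarith),
    max_eq_right (by linarith)]
  ring

theorem abs_sub_le_one_of_mem {t : ℝ} {k : ℤ} (hk : k ∈ ({⌊t⌋, ⌊t⌋ + 1} : Finset ℤ)) :
    |t - k| ≤ 1 := by
  have h1 := Int.floor_le t
  have h2 := Int.lt_floor_add_one t
  simp only [Finset.mem_insert, Finset.mem_singleton] at hk
  rcases hk with rfl | rfl <;> push_cast <;> rw [abs_le] <;> constructor <;> linarith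

theorem pair_floor_subset {s t : ℝ} (h : |s - t| < 1) :
    ({⌊s⌋, ⌊s⌋ + 1} : Finset ℤ) ⊆ Finset.Icc (⌊t⌋ - 1) (⌊t⌋ + 2) := by
  rw [abs_lt] at h
  have h1 : ⌊t⌋ - 1 ≤ ⌊s⌋ := by
    rw [Int.le_floor]
    push_cast
    linarith [Int.floor_le t]
  have h2 : ⌊s⌋ < ⌊t⌋ + 2 := by
    rw [Int.floor_lt]
    push_cast
    linarith [Int.lt_floor_add_one t]
  intro k hk
  simp only [Finset.mem_insert, Finset.mem_singleton] at hk
  rw [Finset.mem_Icc]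
  lia

theorem norm_le_of_forall_abs_le {n : ℕ} {v : EuclideanSpace ℝ (Fin n)} {c : ℝ} (hc : 0 ≤ c)
    (h : ∀ j, |v j| ≤ c) : ‖v‖ ≤ (n + 1) * c := by
  refine abs_le_of_sq_le_sq' ?_ (by positivity) |>.2
  rw [EuclideanSpace.norm_sq_eq]
  calc ∑ j, ‖v j‖ ^ 2 ≤ ∑ _j : Fin n, c ^ 2 :=
        Finset.sum_le_sum fun j _ => pow_le_pow_left₀ (norm_nonneg _) (h j) 2
    _ = n * c ^ 2 := by simp
    _ ≤ ((n + 1) * c) ^ 2 := by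
        rw [mul_pow]
        refine mul_le_mul_of_nonneg_right ?_ (sq_nonneg c)
        have : (0 : ℝ) ≤ n := Nat.cast_nonneg n
        nlinarith

variable {n : ℕ} {X : Set (EuclideanSpace ℝ (Fin n))}

/-- A Whitney type partition of unity off a closed set `E`, each member `θ i` coming with a point
`p i ∈ E` whose distance to the support of `θ i` is comparable to that of `E`. -/
theorem exists_whitney_partition {E : Set X} (hE : IsClosed E) (hne : E.Nonempty) :
    ∃ (ι : Type) (idx : X → Finset ι) (θ : ι → X → ℝ) (p : ι → X),
      (∀ i, p i ∈ E) ∧ (∀ i x, 0 ≤ θ i x) ∧ (∀ x, (idx x).card ≤ 2 * 2 ^ n) ∧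
      (∀ x, ∑ i ∈ idx x, θ i x = 1) ∧
      (∀ x ∉ E, ∀ i ∈ idx x, dist (p i) x ≤ (4 * n + 8) * Metric.infDist x E) ∧
      (∀ x ∉ E, ∀ i, ContinuousAt (θ i) x) ∧
      ∀ x₀ ∉ E, ∃ J : Finset ι, ∀ᶠ x in 𝓝 x₀,
        idx x ⊆ J ∧ ∀ i ∉ idx x, θ i x = 0 := by
  classical
  -- Tents in the logarithmic distance to `E` choose a scale `2 ^ k`; tents in the coordinates
  -- divided by `2 ^ k` choose a lattice point `q`. On `E` the value of `L` is a default one,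
  -- harmless for the sum and cardinality claims.
  let L : X → ℝ := fun x => Real.logb 2 (Metric.infDist x E)
  let c : X → ℤ → Fin n → ℝ := fun x k j => (x : EuclideanSpace ℝ (Fin n)) j / (2 : ℝ) ^ k
  let q : (Σ _ : ℤ, Fin n → ℤ) → EuclideanSpace ℝ (Fin n) := fun i =>
    WithLp.toLp 2 fun j => (2 : ℝ) ^ i.1 * i.2 j
  -- A nearest point of `E` to `q i` need not exist, since `X` is arbitrary; an error of one scale
  -- is affordable.
  have hp : ∀ i : Σ _ : ℤ, Fin n → ℤ, ∃ p : X, p ∈ E ∧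
      ∀ p' ∈ E, dist (q i) p ≤ dist (q i) p' + (2 : ℝ) ^ i.1 := by
    intro i
    have hne' : (Subtype.val '' E).Nonempty := hne.image _
    obtain ⟨_, ⟨p, hpE, rfl⟩, hlt⟩ := (Metric.infDist_lt_iff hne').1
      (lt_add_of_pos_right (Metric.infDist (q i) (Subtype.val '' E))
        (zpow_pos (zero_lt_two' ℝ) i.1))
    refine ⟨p, hpE, fun p' hp' => hlt.le.trans ?_⟩
    gcongr
    exact Metric.infDist_le_dist_of_mem (Set.mem_image_of_mem _ hp')
  choose p hpE hpq using hp
  have hpos : ∀ x ∉ E, 0 < Metric.infDist x E := fun x hx =>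
    (hE.notMem_iff_infDist_pos hne).1 hx
  have hLcont : ∀ x ∉ E, ContinuousAt L x := fun x hx =>
    ((Metric.continuous_infDist_pt E).continuousAt).logb (hpos x hx).ne'
  have hccont : ∀ k j, Continuous fun x => c x k j := fun k j => by
    simp only [c]
    fun_prop
  let idx : X → Finset (Σ _ : ℤ, Fin n → ℤ) := fun x =>
    ({⌊L x⌋, ⌊L x⌋ + 1} : Finset ℤ).sigma fun k =>
      Fintype.piFinset fun j => ({⌊c x k j⌋, ⌊c x k j⌋ + 1} : Finset ℤ)
  let θ : (Σ _ : ℤ, Fin n → ℤ) → X → ℝ := fun i x =>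
    tent (L x - i.1) * ∏ j, tent (c x i.1 j - i.2 j)
  refine ⟨_, idx, θ, p, hpE, ?_, ?_, ?_, ?_, ?_, ?_⟩
  · exact fun i x => mul_nonneg (tent_nonneg _) (Finset.prod_nonneg fun j _ => tent_nonneg _)
  · intro x
    simp only [idx, Finset.card_sigma]
    refine (Finset.sum_le_card_nsmul _ _ (2 ^ n) fun k _ => ?_).trans ?_
    · rw [Fintype.card_piFinset]
      refine (Finset.prod_le_pow_card _ _ 2 fun j _ => Finset.card_le_two).trans ?_
      simp
    · rw [smul_eq_mul]
      exact Nat.mul_le_mul_right _ Finset.card_le_two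
  · intro x
    simp only [idx, θ, Finset.sum_sigma, ← Finset.mul_sum]
    rw [← sum_tent_sub (L x)]
    refine Finset.sum_congr rfl fun k _ => ?_
    rw [← Finset.prod_univ_sum (fun j => ({⌊c x k j⌋, ⌊c x k j⌋ + 1} : Finset ℤ))
      (fun j m => tent (c x k j - m))]
    simp only [sum_tent_sub, Finset.prod_const_one, mul_one]
  · rintro x hx ⟨k, m⟩ hi
    simp only [idx, Finset.mem_sigma, Fintype.mem_piFinset] at hi
    obtain ⟨hk, hm⟩ := hi
    have ht := hpos x hx
    have h2k : (0 : ℝ) < 2 ^ k := zpow_pos two_pos k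
    have hk2 : (2 : ℝ) ^ k ≤ 2 * Metric.infDist x E := by
      have h1 : (k : ℝ) ≤ L x + 1 := by linarith [neg_le_of_abs_le (abs_sub_le_one_of_mem hk)]
      calc (2 : ℝ) ^ k = (2 : ℝ) ^ (k : ℝ) := (Real.rpow_intCast _ _).symm
        _ ≤ (2 : ℝ) ^ (L x + 1) := Real.rpow_le_rpow_of_exponent_le one_le_two h1
        _ = 2 * Metric.infDist x E := by
          rw [Real.rpow_add two_pos, Real.rpow_logb two_pos (by norm_num) ht, Real.rpow_one,
            mul_comm]
    have hqx : dist (q ⟨k, m⟩) x ≤ (n + 1) * (2 : ℝ) ^ k := by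
      rw [dist_comm, dist_eq_norm]
      refine norm_le_of_forall_abs_le h2k.le fun j => ?_
      have h1 := abs_sub_le_one_of_mem (hm j)
      have h2 : ((x : EuclideanSpace ℝ (Fin n)) - q ⟨k, m⟩) j = 2 ^ k * (c x k j - m j) := by
        simp only [q, c, PiLp.sub_apply]
        field_simp
      rw [h2, abs_mul, abs_of_pos h2k]
      exact mul_le_of_le_one_right h2k.le h1
    -- With `D` the distance from `x` to `E`, the triangle inequality through `q` and `p'` gives
    -- `(2n + 3) 2 ^ k + 2 D`, and `2 ^ k ≤ 2 D` yields `4n + 8`.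
    obtain ⟨p', hp', hlt⟩ := (Metric.infDist_lt_iff hne).1
      (show Metric.infDist x E < 2 * Metric.infDist x E by linarith)
    have h1 := hpq ⟨k, m⟩ p' hp'
    have h2 : dist (p ⟨k, m⟩) x ≤ dist (q ⟨k, m⟩) (p ⟨k, m⟩) + dist (q ⟨k, m⟩) x := by
      rw [Subtype.dist_eq]
      exact dist_triangle_left _ _ _
    have h3 : dist (q ⟨k, m⟩) p' ≤ dist (q ⟨k, m⟩) x + dist x p' := by
      rw [Subtype.dist_eq]
      exact dist_triangle _ _ _
    have h4 := mul_le_mul_of_nonneg_left hk2 (show (0 : ℝ) ≤ 2 * n + 3 by positivity)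
    dsimp only at h1
    linarith
  · intro x hx i
    refine ContinuousAt.mul ?_ ?_
    · exact continuous_tent.continuousAt.comp ((hLcont x hx).sub continuousAt_const)
    · exact (continuous_finsetProd _ fun j _ =>
        continuous_tent.comp ((hccont i.1 j).sub continuous_const)).continuousAt
  · intro x₀ hx₀
    refine ⟨(Finset.Icc (⌊L x₀⌋ - 1) (⌊L x₀⌋ + 2)).sigma fun k => Fintype.piFinset fun j =>
      Finset.Icc (⌊c x₀ k j⌋ - 1) (⌊c x₀ k j⌋ + 2), ?_⟩
    have h1 : ∀ᶠ x in 𝓝 x₀, |L x - L x₀| < 1 := by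
      simpa [Real.dist_eq] using (hLcont x₀ hx₀).eventually (Metric.ball_mem_nhds _ one_pos)
    -- The scales must be confined to a finite window first: the coordinates `c` vary ever faster as
    -- `k` decreases.
    have h2 : ∀ᶠ x in 𝓝 x₀, ∀ k ∈ Finset.Icc (⌊L x₀⌋ - 1) (⌊L x₀⌋ + 2), ∀ j,
        |c x k j - c x₀ k j| < 1 := by
      rw [Filter.eventually_all_finset]
      intro k _
      rw [Filter.eventually_all]
      intro j
      simpa [Real.dist_eq] using
        (hccont k j).continuousAt.eventually (Metric.ball_mem_nhds (c x₀ k j) one_pos)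
    filter_upwards [h1, h2] with x hx1 hx2
    refine ⟨?_, ?_⟩
    · rintro ⟨k, m⟩ hi
      simp only [idx, Finset.mem_sigma, Fintype.mem_piFinset] at hi ⊢
      have hk := pair_floor_subset hx1 hi.1
      exact ⟨hk, fun j => pair_floor_subset (hx2 k hk j) (hi.2 j)⟩
    · rintro ⟨k, m⟩ hi
      simp only [idx, Finset.mem_sigma, Fintype.mem_piFinset, not_and_or, not_forall] at hi
      rcases hi with hi | ⟨j, hj⟩
      · simp only [θ, tent_sub_eq_zero hi, zero_mul]
      · simp only [θ]
        rw [Finset.prod_eq_zero (Finset.mem_univ j) (tent_sub_eq_zero hj), mul_zero]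

/-- Continuous functions on a closed subset `E` of `X ⊆ ℝ^n` can be extended to `X` by a linear
operator of norm one and of depth bounded in terms of `n`. -/
theorem exists_extension_hasDepth {V : Type*} [NormedAddCommGroup V] [NormedSpace ℝ V]
    {E : Set X} (hE : IsClosed E) :
    ∃ T : (X → V) → X → V, (∀ x, HasDepth (2 * 2 ^ n) fun u => T u x) ∧
      ∀ u, (ContinuousOn u E → Continuous (T u)) ∧ (∀ x ∈ E, T u x = u x) ∧
        ∀ M, 0 ≤ M → (∀ p ∈ E, ‖u p‖ ≤ M) → ∀ x, ‖T u x‖ ≤ M := by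
  classical
  rcases E.eq_empty_or_nonempty with rfl | hne
  · exact ⟨fun _ _ => 0, fun x => hasDepth_zero _, fun u => ⟨fun _ => continuous_const,
      by simp, fun M hM _ x => by simpa using hM⟩⟩
  obtain ⟨ι, idx, θ, p, hpE, hθ, hcard, hsum, hdist, hcont, hloc⟩ :=
    exists_whitney_partition hE hne
  let T : (X → V) → X → V := fun u x => if x ∈ E then u x else ∑ i ∈ idx x, θ i x • u (p i)
  have hTE : ∀ u, ∀ x ∈ E, T u x = u x := fun u x hx => if_pos hx
  have hTnE : ∀ u, ∀ x ∉ E, T u x = ∑ i ∈ idx x, θ i x • u (p i) := fun u x hx => if_neg hx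
  refine ⟨T, fun x => ?_, fun u => ⟨fun hu => ?_, hTE u, fun M hM hbd x => ?_⟩⟩
  · by_cases hx : x ∈ E
    · simp only [hTE _ x hx]
      exact (hasDepth_eval x).mono (Nat.one_le_iff_ne_zero.2 (by positivity))
    · simp only [hTnE _ x hx]
      refine (HasDepth.sum (d := 1) (idx x) fun i _ => ?_).mono (by simpa using hcard x)
      exact (hasDepth_eval (p i)).map (LinearMap.lsmul ℝ V (θ i x))
  · rw [continuous_iff_continuousAt]
    intro x₀
    by_cases hx₀ : x₀ ∈ E
    · rw [Metric.continuousAt_iff]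
      intro ε hε
      obtain ⟨η, hη, hu'⟩ := Metric.continuousOn_iff.1 hu x₀ hx₀ (ε / 2) (half_pos hε)
      -- `4n + 8` bounds the distance from `p i` to `x`, and one more covers that from `x` to `x₀`.
      refine ⟨η / (4 * n + 9), by positivity, fun {x} hx => ?_⟩
      rw [lt_div_iff₀ (by positivity)] at hx
      rw [hTE u x₀ hx₀]
      by_cases hxE : x ∈ E
      · rw [hTE u x hxE]
        refine (hu' x hxE ?_).trans (half_lt_self hε)
        refine lt_of_le_of_lt (le_mul_of_one_le_right dist_nonneg ?_) hx
        have : (0 : ℝ) ≤ n := Nat.cast_nonneg n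
        linarith
      · rw [hTnE u x hxE, dist_eq_norm]
        have e : ∑ i ∈ idx x, θ i x • u (p i) - u x₀ =
            ∑ i ∈ idx x, θ i x • (u (p i) - u x₀) := by
          simp only [smul_sub, Finset.sum_sub_distrib, ← Finset.sum_smul, hsum, one_smul]
        rw [e]
        refine lt_of_le_of_lt ?_ (half_lt_self hε)
        calc ‖∑ i ∈ idx x, θ i x • (u (p i) - u x₀)‖
            ≤ ∑ i ∈ idx x, θ i x * (ε / 2) := norm_sum_le_of_le _ fun i hi => by
              rw [norm_smul, Real.norm_of_nonneg (hθ i x)]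
              refine mul_le_mul_of_nonneg_left ?_ (hθ i x)
              rw [← dist_eq_norm]
              refine (hu' (p i) (hpE i) ?_).le
              have h1 := hdist x hxE i hi
              have h2 := dist_triangle (p i) x x₀
              have h3 := mul_le_mul_of_nonneg_left (Metric.infDist_le_dist_of_mem (x := x) hx₀)
                (show (0 : ℝ) ≤ 4 * n + 8 by positivity)
              linarith
          _ = ε / 2 := by rw [← Finset.sum_mul, hsum, one_mul]
    · obtain ⟨J, hJ⟩ := hloc x₀ hx₀
      have hev : T u =ᶠ[𝓝 x₀] fun x => ∑ i ∈ J, θ i x • u (p i) := by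
        filter_upwards [hJ, hE.isOpen_compl.mem_nhds hx₀] with x hx hxE
        rw [hTnE u x hxE]
        exact Finset.sum_subset hx.1 fun i _ hi => by rw [hx.2 i hi, zero_smul]
      refine ContinuousAt.congr ?_ hev.symm
      exact tendsto_finsetSum _ fun i _ => (hcont x₀ hx₀ i).smul continuousAt_const
  · by_cases hx : x ∈ E
    · rw [hTE u x hx]
      exact hbd x hx
    · rw [hTnE u x hx]
      calc ‖∑ i ∈ idx x, θ i x • u (p i)‖ ≤ ∑ i ∈ idx x, θ i x * M :=
            norm_sum_le_of_le _ fun i _ => by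
              rw [norm_smul, Real.norm_of_nonneg (hθ i x)]
              exact mul_le_mul_of_nonneg_left (hbd _ (hpE i)) (hθ i x)
        _ = M := by rw [← Finset.sum_mul, hsum, one_mul]

end Extension

/-! ### Continuous selection by induction on fiber dimension -/

section Selection

variable {r : ℕ}

theorem isClosed_finrank_lt {X : Type*} [TopologicalSpace X] {H : X → Submodule ℝ (Vec r)}
    (hH : glaeser H = H) (k : ℕ) : IsClosed {x | Module.finrank ℝ (H x) < k} := by
  rw [← isOpen_compl_iff, isOpen_iff_eventually]
  intro x hx
  have h := finrank_glaeser_le_eventually H x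
  rw [hH] at h
  filter_upwards [h] with y hy
  simp only [Set.mem_compl_iff, Set.mem_ofPred_eq, not_lt] at hx ⊢
  exact hx.trans hy

theorem continuousWithinAt_starProjection_apply {X : Type*} [TopologicalSpace X]
    {H : X → Submodule ℝ (Vec r)} (hH : glaeser H = H) {s : Set X} {x : X}
    (hs : ∀ y ∈ s, Module.finrank ℝ (H y) = Module.finrank ℝ (H x)) {u : X → Vec r}
    (hu : Continuous u) : ContinuousWithinAt (fun y => (H y).starProjection (u y)) s x := by
  have h1 : Tendsto (fun y => (H y).starProjection (u y - u x)) (𝓝[s] x) (𝓝 0) := by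
    refine squeeze_zero_norm (fun y => (H y).norm_starProjection_apply_le _) ?_
    exact (tendsto_iff_norm_sub_tendsto_zero.1 hu.continuousAt).mono_left nhdsWithin_le_nhds
  have h2 := h1.add (tendsto_starProjection_of_finrank_eq hH hs (u x))
  rw [zero_add] at h2
  refine h2.congr fun y => ?_
  rw [← map_add, sub_add_cancel]

/-- A linear selection of bounded depth for a Glaeser stable bundle, over the set of points at
which the fiber has dimension less than `k`. -/
theorem exists_selection_finrank_lt (n r k : ℕ) :
    ∃ d : ℕ, ∀ (X : Set (EuclideanSpace ℝ (Fin n))) (H : X → Submodule ℝ (Vec r)),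
      glaeser H = H → ∃ T : (X → Vec r) → X → Vec r, (∀ x, HasDepth d fun g => T g x) ∧
        ∀ F : X → Vec r, Continuous F → ∀ g : X → Vec r,
          (∀ x, g x = F x - (H x).starProjection (F x)) →
          ContinuousOn (T g) {x | Module.finrank ℝ (H x) < k} ∧
          ∀ x, Module.finrank ℝ (H x) < k → T g x - F x ∈ H x ∧
            ∀ M, 0 ≤ M → (∀ y, ‖F y‖ ≤ M) → ‖T g x‖ ≤ k * M := by
  classical
  induction k with
  | zero =>
    exact ⟨0, fun X H _ => ⟨fun _ _ => 0, fun _ => hasDepth_zero 0, fun F _ g _ => by simp⟩⟩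
  | succ k ih =>
    obtain ⟨d, hd⟩ := ih
    refine ⟨d + (1 + 2 * 2 ^ n * d), fun X H hH => ?_⟩
    obtain ⟨T, hTd, hT⟩ := hd X H hH
    have hE := isClosed_finrank_lt hH k
    obtain ⟨P, hPd, hP⟩ := exists_extension_hasDepth (V := Vec r) hE
    -- On the new stratum take the point of the affine fiber `F x + H x` nearest to the extension.
    -- Written through `g`, it does not involve `F`.
    let T' : (X → Vec r) → X → Vec r := fun g x =>
      if Module.finrank ℝ (H x) < k then T g x else g x + (H x).starProjection (P (T g) x)
    have hpos : ∀ g x, Module.finrank ℝ (H x) < k → T' g x = T g x := fun g x hx => if_pos hx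
    have hneg : ∀ g x, ¬ Module.finrank ℝ (H x) < k →
        T' g x = g x + (H x).starProjection (P (T g) x) := fun g x hx => if_neg hx
    refine ⟨T', fun x => ?_, fun F hF g hg => ?_⟩
    · by_cases hx : Module.finrank ℝ (H x) < k
      · simp only [hpos _ x hx]
        exact (hTd x).mono (Nat.le_add_right _ _)
      · simp only [hneg _ x hx]
        exact ((hasDepth_eval x).add (((hPd x).comp hTd).map
          (H x).starProjection.toLinearMap)).mono (Nat.le_add_left _ _)
    obtain ⟨hTc, hTm⟩ := hT F hF g hg
    obtain ⟨hPc, hPeq, hPb⟩ := hP (T g)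
    have hΨ : Continuous (P (T g)) := hPc hTc
    have hneg' : ∀ x, ¬ Module.finrank ℝ (H x) < k →
        T' g x = F x + (H x).starProjection (P (T g) x - F x) := fun x hx => by
      rw [hneg g x hx, hg, map_sub]
      abel
    refine ⟨fun x hx => ?_, fun x hx => ?_⟩
    · by_cases hxk : Module.finrank ℝ (H x) < k
      · refine ContinuousAt.continuousWithinAt ?_
        -- Where the fiber is larger, the difference measures how far `P (T g) y - F y` is from `H
        -- y`. Stability supplies a competitor, the projection of `T g x - F x ∈ H x`.
        have hdiff : Tendsto (fun y => T' g y - P (T g) y) (𝓝 x) (𝓝 0) := by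
          have h0 : Tendsto (fun y => ‖(P (T g) y - F y) -
              (H y).starProjection (T g x - F x)‖) (𝓝 x) (𝓝 0) := by
            have h1 := (((hΨ.sub hF).continuousAt (x := x)).tendsto.sub
              (tendsto_starProjection_of_mem_glaeser (H := H) (x := x) (v := T g x - F x)
                (by rw [hH]; exact (hTm x hxk).1))).norm
            simpa [hPeq x hxk] using h1
          refine squeeze_zero_norm (fun y => ?_) h0
          by_cases hy : Module.finrank ℝ (H y) < k
          · rw [hpos g y hy, hPeq y hy, sub_self, norm_zero]
            exact norm_nonneg _
          · refine le_trans (le_of_eq ?_) (norm_sub_starProjection_le (H y) (P (T g) y - F y)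
              ((H y).starProjection_apply_mem (T g x - F x)))
            rw [hneg' y hy, ← norm_neg]
            congr 1
            abel
        have h2 := hdiff.add hΨ.continuousAt
        simp only [sub_add_cancel, zero_add] at h2
        rw [ContinuousAt, hpos g x hxk, ← hPeq x hxk]
        exact h2
      · have hs : {y | Module.finrank ℝ (H y) < k + 1} ∩ {y | Module.finrank ℝ (H y) < k}ᶜ ∈
            𝓝[{y | Module.finrank ℝ (H y) < k + 1}] x :=
          inter_mem_nhdsWithin _ (hE.isOpen_compl.mem_nhds hxk)
        refine ContinuousWithinAt.mono_of_mem_nhdsWithin ?_ hs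
        refine (hF.continuousWithinAt.add
          (continuousWithinAt_starProjection_apply hH (fun y hy => ?_) (hΨ.sub hF))).congr
          (fun y hy => hneg' y hy.2) (hneg' x hxk)
        simp only [Set.mem_inter_iff, Set.mem_ofPred_eq, Set.mem_compl_iff] at hy hx
        exact (le_antisymm (Nat.le_of_lt_succ hy.1) (not_lt.1 hy.2)).trans
          (le_antisymm (not_lt.1 hxk) (Nat.le_of_lt_succ hx))
    · by_cases hxk : Module.finrank ℝ (H x) < k
      · rw [hpos g x hxk]
        refine ⟨(hTm x hxk).1, fun M hM hFM => ((hTm x hxk).2 M hM hFM).trans ?_⟩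
        push_cast
        linarith
      · refine ⟨?_, fun M hM hFM => ?_⟩
        · rw [hneg' x hxk, add_sub_cancel_left]
          exact (H x).starProjection_apply_mem _
        · rw [hneg g x hxk]
          have h1 : ‖g x‖ ≤ M := by
            rw [hg]
            refine (norm_sub_starProjection_le (H x) (F x) (H x).zero_mem).trans ?_
            rw [sub_zero]
            exact hFM x
          have h2 : ‖(H x).starProjection (P (T g) x)‖ ≤ k * M :=
            ((H x).norm_starProjection_apply_le _).trans
              (hPb (k * M) (by positivity) (fun p hp => (hTm p hp).2 M hM hFM) x)
          refine (norm_add_le _ _).trans ?_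
          push_cast
          linarith

end Selection

/-! ### What the iterated limits compute -/

section Procedure

variable {X : Type*} {r : ℕ}

/-- The normals to the kernel fiber are the multiples of `f y`, and `ξ̃ φ` is the component of `F`
along `f y`; at a common zero both sides vanish. -/
theorem sum_mul_xiTilde_eq_inner {f : Fin r → X → ℝ} {y : X} {c : Fin r → ℝ} {F : Vec r}
    (hc : (∑ j, c j • EuclideanSpace.single j (1 : ℝ) : Vec r) ∈ (kernelBundle f y)ᗮ) :
    ∑ j, c j * (xiTilde f y j * ∑ i, F i * f i y) =
      ⟪(∑ j, c j • EuclideanSpace.single j (1 : ℝ) : Vec r), F⟫_ℝ := by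
  have hinner : ∀ G : Vec r, ⟪(∑ j, c j • EuclideanSpace.single j (1 : ℝ) : Vec r), G⟫_ℝ =
      ∑ j, c j * G j := fun G => by
    simp [sum_inner, inner_smul_left, EuclideanSpace.inner_single_left]
  by_cases hf : ∀ j, f j y = 0
  · have hF : F ∈ kernelBundle f y := by
      change ∑ i, F i * f i y = 0
      simp [hf]
    rw [Submodule.inner_left_of_mem_orthogonal hF hc]
    simp [xiTilde, hf]
  · have hN : ∑ j, f j y ^ 2 ≠ 0 := fun h => hf fun j => by
      have := (Finset.sum_eq_zero_iff_of_nonneg fun j _ => sq_nonneg (f j y)).1 h j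
        (Finset.mem_univ j)
      exact pow_eq_zero_iff two_ne_zero |>.1 this
    let t : ℝ := (∑ i, F i * f i y) / ∑ j, f j y ^ 2
    have hmem : F - t • WithLp.toLp 2 (fun j => f j y) ∈ kernelBundle f y := by
      change ∑ i, (F - t • WithLp.toLp 2 (fun j => f j y)) i * f i y = 0
      have : ∀ i, (F - t • WithLp.toLp 2 (fun j => f j y)) i * f i y =
          F i * f i y - t * f i y ^ 2 := fun i => by
        simp only [PiLp.sub_apply, PiLp.smul_apply, smul_eq_mul]
        ring
      simp only [this, Finset.sum_sub_distrib, ← Finset.mul_sum]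
      simp only [t]
      field_simp
      ring
    have h0 := Submodule.inner_left_of_mem_orthogonal hmem hc
    rw [inner_sub_right, sub_eq_zero] at h0
    rw [h0, hinner]
    refine Finset.sum_congr rfl fun j _ => ?_
    simp only [xiTilde, if_neg hf, PiLp.smul_apply, smul_eq_mul, t]
    ring

/-- The part of the combination along `K` lies in both `K` and `Kᗮ`. Hence the indices where `ξ`
carries no information never contribute. -/
theorem eq_zero_of_sum_smul_mem_orthogonal {b : Fin r → Vec r} (hb : LinearIndependent ℝ b)
    {K : Submodule ℝ (Vec r)} {s : ℕ} (hlt : ∀ i : Fin r, (i : ℕ) < s → b i ∈ Kᗮ)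
    (hge : ∀ i : Fin r, s ≤ (i : ℕ) → b i ∈ K) {c : Fin r → ℝ} (hc : ∑ j, c j • b j ∈ Kᗮ)
    {j : Fin r} (hj : s ≤ (j : ℕ)) : c j = 0 := by
  let d : Fin r → ℝ := fun j => if s ≤ (j : ℕ) then c j else 0
  have hd : ∑ j, d j • b j ∈ K := Submodule.sum_mem _ fun j _ => by
    by_cases h : s ≤ (j : ℕ)
    · exact K.smul_mem _ (hge j h)
    · simp [d, h]
  have hd' : ∑ j, d j • b j ∈ Kᗮ := by
    have e : ∑ j, d j • b j = ∑ j, c j • b j - ∑ j, (c j - d j) • b j := by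
      rw [← Finset.sum_sub_distrib]
      refine Finset.sum_congr rfl fun j _ => ?_
      rw [← sub_smul, sub_sub_cancel]
    rw [e]
    refine Submodule.sub_mem _ hc (Submodule.sum_mem _ fun j _ => ?_)
    by_cases h : s ≤ (j : ℕ)
    · simp [d, h]
    · exact Submodule.smul_mem _ _ (hlt j (not_le.1 h))
  have h0 : ∑ j, d j • b j = 0 :=
    inner_self_eq_zero.1 (Submodule.inner_right_of_mem_orthogonal (𝕜 := ℝ) hd hd')
  have := Fintype.linearIndependent_iff.1 hb d h0 j
  simpa [d, hj] using this

/-- The limit data enter the output only through the vectors `∑ ξ_j w_j`, so `S` and `A` can be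
fixed before them. -/
theorem output_eq (f : Fin r → X → ℝ) (D : LimitData X r) (φ : X → ℝ) (S : X → Finset X)
    (A : X → X → Vec r →ₗ[ℝ] Vec r) (i : Fin r) (x : X) :
    output f D S A φ i x =
      (∑ y ∈ S x, A x y (∑ j, xi f D φ (2 * r + 1) y j • D.w y j)) i := by
  simp [output, coeff, map_sum, mul_comm]

variable [TopologicalSpace X] {f : Fin r → X → ℝ} {D : LimitData X r} {φ : X → ℝ}
  {F : X → Vec r}

-- The expansion of `lamSeq` turns each term into its inner product with `F` at the moving point,
-- and both factors converge. For the trailing indices the terms vanish identically.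
open Classical in
theorem tendsto_of_sum_mul_xi_eq_inner {H : X → Submodule ℝ (Vec r)} (hD : D.IsAdmissible H)
    (hF : Continuous F) {ℓ : ℕ} (hℓ : ℓ < 2 * r + 1)
    (hxi : ∀ (y : X) (c : Fin r → ℝ), ∑ j, c j • D.lam ℓ y j ∈ (glaeserIter H ℓ y)ᗮ →
      ∑ j, c j * xi f D φ ℓ y j = ⟪∑ j, c j • D.lam ℓ y j, F y⟫_ℝ) (x : X) (i : Fin r) :
    Tendsto (fun ν : ℕ => ∑ j, D.β (ℓ + 1) ν x i j * xi f D φ ℓ (D.y (ℓ + 1) ν x i) j) atTop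
      (𝓝 (if (i : ℕ) < Module.finrank ℝ (glaeserIter H (ℓ + 1) x)ᗮ then
        ⟪D.lam (ℓ + 1) x i, F x⟫_ℝ else 0)) := by
  have e : ∀ ν, ∑ j, D.β (ℓ + 1) ν x i j * xi f D φ ℓ (D.y (ℓ + 1) ν x i) j =
      ⟪D.lamSeq (ℓ + 1) ν x i, F (D.y (ℓ + 1) ν x i)⟫_ℝ := fun ν => by
    have h := hD.lamSeq_expand ℓ hℓ ν x i
    rw [h]
    refine hxi _ _ ?_
    rw [← h]
    exact hD.lamSeq_orthogonal ℓ hℓ ν x i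
  simp only [e]
  split_ifs with hi
  · exact (hD.lamSeq_tendsto ℓ hℓ x i hi).inner
      ((hF.tendsto x).comp (hD.y_tendsto ℓ hℓ x i))
  · simp [hD.lamSeq_eq ℓ hℓ _ x i (not_lt.1 hi)]

/-- For a function `φ = ∑ F_i f_i` with `F` continuous, the numbers `ξ^ℓ_j(y)` encode the
orthogonal projection of `F y` onto the orthogonal complement of the fiber of `H^ℓ`. -/
theorem sum_mul_xi_eq_inner (hD : D.IsAdmissible (kernelBundle f)) (hF : Continuous F)
    (hφ : ∀ x, ∑ i, F x i * f i x = φ x) {ℓ : ℕ} (hℓ : ℓ ≤ 2 * r + 1) :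
    ∀ (y : X) (c : Fin r → ℝ),
      ∑ j, c j • D.lam ℓ y j ∈ (glaeserIter (kernelBundle f) ℓ y)ᗮ →
      ∑ j, c j * xi f D φ ℓ y j = ⟪∑ j, c j • D.lam ℓ y j, F y⟫_ℝ := by
  classical
  induction ℓ with
  | zero =>
    intro y c hc
    simp only [hD.lam_zero] at hc ⊢
    simp only [xi, ← hφ]
    exact sum_mul_xiTilde_eq_inner hc
  | succ ℓ ih =>
    intro y c hc
    have hℓ' : ℓ < 2 * r + 1 := hℓ
    rw [sum_inner]
    refine Finset.sum_congr rfl fun j _ => ?_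
    rw [real_inner_smul_left]
    by_cases hj : (j : ℕ) < Module.finrank ℝ (glaeserIter (kernelBundle f) (ℓ + 1) y)ᗮ
    · have h := tendsto_of_sum_mul_xi_eq_inner hD hF hℓ' (ih hℓ'.le) y j
      rw [if_pos hj] at h
      rw [← h.limUnder_eq]
      rfl
    · rw [eq_zero_of_sum_smul_mem_orthogonal (hD.lam_basis ℓ hℓ' y)
        (hD.lam_mem_orthogonal ℓ hℓ' y) (hD.lam_mem ℓ hℓ' y) hc (not_lt.1 hj), zero_mul, zero_mul]

theorem succeeds_of_continuous (hD : D.IsAdmissible (kernelBundle f)) (hF : Continuous F)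
    (hφ : ∀ x, ∑ i, F x i * f i x = φ x) : Succeeds f D φ := by
  classical
  exact fun ℓ hℓ x i =>
    ⟨_, tendsto_of_sum_mul_xi_eq_inner hD hF hℓ (sum_mul_xi_eq_inner hD hF hφ hℓ.le) x i⟩

/-- The `ξ_j` are the inner products of the final basis with the residue of `F`, and the dual family
`w` reassembles it. -/
theorem sum_xi_smul_w (hD : D.IsAdmissible (kernelBundle f)) (hF : Continuous F)
    (hφ : ∀ x, ∑ i, F x i * f i x = φ x) (y : X) :
    ∑ j, xi f D φ (2 * r + 1) y j • D.w y j =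
      F y - (glaeserIter (kernelBundle f) (2 * r + 1) y).starProjection (F y) := by
  classical
  set K := glaeserIter (kernelBundle f) (2 * r + 1) y with hK
  rw [hD.w_dual y (F y - K.starProjection (F y))]
  refine Finset.sum_congr rfl fun j _ => ?_
  congr 1
  have hr : 2 * r < 2 * r + 1 := Nat.lt_succ_self _
  have h := (tendsto_of_sum_mul_xi_eq_inner hD hF hr
    (sum_mul_xi_eq_inner hD hF hφ hr.le) y j).limUnder_eq
  change xi f D φ (2 * r + 1) y j = _ at h
  rw [h]
  split_ifs with hj
  · rw [inner_sub_right, Submodule.inner_left_of_mem_orthogonal (K.starProjection_apply_mem _)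
      (hD.lam_mem_orthogonal (2 * r) hr y j hj), sub_zero]
  · exact (Submodule.inner_right_of_mem_orthogonal (hD.lam_mem (2 * r) hr y j (not_lt.1 hj))
      (Submodule.sub_starProjection_mem_orthogonal _)).symm

end Procedure

/-! ### Existence of admissible limit data -/

section LimitData

variable {r : ℕ}

/-- The leading basis vectors must themselves be limits of normals, so they are extracted from `L`
rather than from its span. -/
theorem exists_basis_of_span_eq_orthogonal (K : Submodule ℝ (Vec r)) {L : Set (Vec r)}
    (hL : Submodule.span ℝ L = Kᗮ) :
    ∃ b : Fin r → Vec r, LinearIndependent ℝ b ∧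
      (∀ i : Fin r, (i : ℕ) < Module.finrank ℝ Kᗮ → b i ∈ L) ∧
      ∀ i : Fin r, Module.finrank ℝ Kᗮ ≤ (i : ℕ) → b i ∈ K := by
  obtain ⟨B, hBL, hBspan, hB⟩ := exists_linearIndependent ℝ L
  have : Fintype B := hB.setFinite.fintype
  have hcard : Fintype.card B = Module.finrank ℝ Kᗮ := by
    rw [← hL, ← hBspan, ← finrank_span_eq_card hB, Subtype.range_coe]
  let u : Fin (Module.finrank ℝ Kᗮ) ≃ B := (Fintype.equivFinOfCardEq hcard).symm
  let b := Module.finBasis ℝ K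
  have hb : LinearIndependent ℝ fun i => (b i : Vec r) :=
    b.linearIndependent.map' K.subtype (Submodule.ker_subtype _)
  have hu : LinearIndependent ℝ fun i => (u i : Vec r) := hB.comp u u.injective
  have hdisj : Disjoint (Submodule.span ℝ (Set.range fun i => (u i : Vec r)))
      (Submodule.span ℝ (Set.range fun i => (b i : Vec r))) := by
    refine (K.orthogonal_disjoint.symm).mono ?_ ?_
    · refine Submodule.span_le.2 ?_
      rintro _ ⟨i, rfl⟩
      exact hL.le (Submodule.subset_span (hBL (u i).2))
    · refine Submodule.span_le.2 ?_
      rintro _ ⟨i, rfl⟩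
      exact (b i).2
  have hsum : Module.finrank ℝ Kᗮ + Module.finrank ℝ K = r := by
    rw [add_comm, K.finrank_add_finrank_orthogonal, finrank_euclideanSpace_fin]
  let e : Fin (Module.finrank ℝ Kᗮ) ⊕ Fin (Module.finrank ℝ K) ≃ Fin r :=
    finSumFinEquiv.trans (finCongr hsum)
  refine ⟨Sum.elim (fun i => (u i : Vec r)) (fun i => (b i : Vec r)) ∘ e.symm,
    (hu.sum_type hb hdisj).comp _ e.symm.injective, fun i hi => ?_, fun i hi => ?_⟩
  · obtain ⟨a | a, rfl⟩ := e.surjective i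
    · simpa using hBL (u a).2
    · simp [e] at hi
  · obtain ⟨a | a, rfl⟩ := e.surjective i
    · simp only [e, Equiv.trans_apply, finSumFinEquiv_apply_left, finCongr_apply,
        Fin.val_cast, Fin.val_castAdd] at hi
      exact absurd hi (not_le.2 a.2)
    · simp

theorem span_range_eq_top {b : Fin r → Vec r} (hb : LinearIndependent ℝ b) :
    Submodule.span ℝ (Set.range b) = ⊤ :=
  hb.span_eq_top_of_card_eq_finrank' (by simp)

theorem exists_eq_sum_smul {b : Fin r → Vec r} (hb : LinearIndependent ℝ b) (v : Vec r) :
    ∃ c : Fin r → ℝ, v = ∑ j, c j • b j := by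
  obtain ⟨c, hc⟩ := (Submodule.mem_span_range_iff_exists_fun ℝ).1
    (span_range_eq_top hb ▸ Submodule.mem_top : v ∈ Submodule.span ℝ (Set.range b))
  exact ⟨c, hc.symm⟩

theorem exists_dual_family {b : Fin r → Vec r} (hb : LinearIndependent ℝ b) :
    ∃ w : Fin r → Vec r, ∀ v : Vec r, v = ∑ i, ⟪b i, v⟫_ℝ • w i := by
  let M : Vec r →ₗ[ℝ] Fin r → ℝ := LinearMap.pi fun i => (innerSL ℝ (b i)).toLinearMap
  have hM : ∀ v i, M v i = ⟪b i, v⟫_ℝ := fun v i => rfl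
  have hinj : Function.Injective M := by
    rw [injective_iff_map_eq_zero]
    intro v hv
    obtain ⟨c, hc⟩ := exists_eq_sum_smul hb v
    have h : ⟪∑ j, c j • b j, v⟫_ℝ = 0 := by
      simp only [sum_inner, real_inner_smul_left, ← hM, hv, Pi.zero_apply, mul_zero,
        Finset.sum_const_zero]
    rw [← hc] at h
    exact inner_self_eq_zero.1 h
  let e := LinearEquiv.ofInjectiveOfFinrankEq M hinj (by simp)
  refine ⟨fun i => e.symm (Pi.single i 1), fun v => ?_⟩
  have h : e.symm (∑ i, e v i • Pi.single i (1 : ℝ)) = v := by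
    rw [← pi_eq_sum_univ' (e v), e.symm_apply_apply]
  simp only [map_sum, map_smul] at h
  exact h.symm

variable {X : Type*} [TopologicalSpace X]

/-- The orthogonal complement of a fiber of the Glaeser refinement is spanned by the limits of
vectors orthogonal to the neighbouring fibers. -/
theorem span_limits_eq_glaeser_orthogonal (H : X → Submodule ℝ (Vec r)) (x : X) :
    Submodule.span ℝ {μ | (x, μ) ∈ closure {p : X × Vec r | p.2 ∈ (H p.1)ᗮ}} =
      (glaeser H x)ᗮ := by
  refine le_antisymm (Submodule.span_le.2 fun μ hμ => ?_) ?_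
  · obtain ⟨U, hU, hUx⟩ := mem_closure_iff_ultrafilter.1 hμ
    rw [SetLike.mem_coe, Submodule.mem_orthogonal]
    intro v hv
    have h1 : Tendsto (fun p : X × Vec r => p.1) U (𝓝 x) := (continuous_fst.tendsto _).mono_left hUx
    have h2 : Tendsto (fun p : X × Vec r => p.2) U (𝓝 μ) := (continuous_snd.tendsto _).mono_left hUx
    have h3 := ((tendsto_starProjection_of_mem_glaeser hv).comp h1).inner (𝕜 := ℝ) h2
    refine tendsto_nhds_unique h3 (tendsto_const_nhds.congr' ?_)
    filter_upwards [hU] with p hp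
    exact (Submodule.inner_right_of_mem_orthogonal ((H p.1).starProjection_apply_mem v) hp).symm
  · rw [← Submodule.orthogonal_orthogonal (Submodule.span ℝ _)]
    refine Submodule.orthogonal_le fun v hv => ?_
    have hv' : ∀ μ, (x, μ) ∈ closure {p : X × Vec r | p.2 ∈ (H p.1)ᗮ} → ⟪μ, v⟫_ℝ = 0 :=
      fun μ hμ => (Submodule.mem_orthogonal _ _).1 hv μ (Submodule.subset_span hμ)
    have hvx : v ∈ H x := by
      rw [← Submodule.orthogonal_orthogonal (H x), Submodule.mem_orthogonal]
      exact fun μ hμ => hv' μ (subset_closure hμ)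
    refine mem_glaeser.2 ⟨hvx, ?_⟩
    simp only [infDist_eq_norm_sub_starProjection]
    rw [← tendsto_zero_iff_norm_tendsto_zero]
    -- A cluster point `w` of the residues of `v` is a limit of normals, so `⟪w, v⟫ = 0`; but `⟪w,
    -- w⟫ = ⟪w, v⟫`, so `w = 0`.
    refine (isCompact_closedBall (0 : Vec r) ‖v‖).tendsto_nhds_of_unique_mapClusterPt
      (Eventually.of_forall fun y => ?_) fun w _ hw => ?_
    · rw [mem_closedBall_zero_iff]
      simpa using norm_sub_starProjection_le (H y) v (H y).zero_mem
    · obtain ⟨U, hU, hUw⟩ := mapClusterPt_iff_ultrafilter.1 hw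
      have hmem : (x, w) ∈ closure {p : X × Vec r | p.2 ∈ (H p.1)ᗮ} := by
        refine mem_closure_of_tendsto
          (f := fun y => (y, v - (H y).starProjection v)) (b := (U : Filter X))
          (Tendsto.prodMk_nhds (tendsto_id.mono_left hU) hUw) (Eventually.of_forall fun y => ?_)
        exact Submodule.sub_starProjection_mem_orthogonal (K := H y) v
      have h1 : Tendsto (fun y => ⟪v - (H y).starProjection v, v⟫_ℝ) U (𝓝 ⟪w, v⟫_ℝ) :=
        hUw.inner tendsto_const_nhds
      have h2 : Tendsto (fun y => ⟪v - (H y).starProjection v, v - (H y).starProjection v⟫_ℝ) U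
          (𝓝 ⟪w, w⟫_ℝ) := hUw.inner hUw
      have h3 : ⟪w, w⟫_ℝ = ⟪w, v⟫_ℝ := by
        refine tendsto_nhds_unique h2 (h1.congr fun y => ?_)
        rw [inner_sub_right (v - (H y).starProjection v) v, Submodule.starProjection_inner_eq_zero
          v _ ((H y).starProjection_apply_mem v), sub_zero]
      rw [hv' w hmem] at h3
      exact inner_self_eq_zero.1 h3

theorem exists_isAdmissible [FirstCountableTopology X] (H : X → Submodule ℝ (Vec r)) :
    ∃ D : LimitData X r, D.IsAdmissible H := by
  have hb := fun (ℓ : ℕ) (x : X) => exists_basis_of_span_eq_orthogonal (glaeserIter H (ℓ + 1) x)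
    (L := {μ | (x, μ) ∈ closure {p : X × Vec r | p.2 ∈ (glaeserIter H ℓ p.1)ᗮ}})
    (by rw [glaeserIter_succ, span_limits_eq_glaeser_orthogonal])
  choose b hbi hblt hbge using hb
  have hz : ∀ (ℓ : ℕ) (x : X) (i : Fin r), ∃ z : ℕ → X × Vec r,
      (∀ ν, (z ν).2 ∈ (glaeserIter H ℓ (z ν).1)ᗮ) ∧ Tendsto (fun ν => (z ν).1) atTop (𝓝 x) ∧
      ((i : ℕ) < Module.finrank ℝ (glaeserIter H (ℓ + 1) x)ᗮ →
        Tendsto (fun ν => (z ν).2) atTop (𝓝 (b ℓ x i))) ∧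
      (Module.finrank ℝ (glaeserIter H (ℓ + 1) x)ᗮ ≤ (i : ℕ) → ∀ ν, z ν = (x, 0)) := by
    intro ℓ x i
    by_cases hi : (i : ℕ) < Module.finrank ℝ (glaeserIter H (ℓ + 1) x)ᗮ
    · obtain ⟨z, hz, hzx⟩ := mem_closure_iff_seq_limit.1 (hblt ℓ x i hi)
      exact ⟨z, hz, (continuous_fst.tendsto _).comp hzx,
        fun _ => (continuous_snd.tendsto _).comp hzx, fun h => absurd hi (not_lt.2 h)⟩
    · exact ⟨fun _ => (x, 0), fun _ => Submodule.zero_mem _, tendsto_const_nhds,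
        fun h => absurd h hi, fun _ _ => rfl⟩
  choose z hzo hzx hzb hzc using hz
  let lam : ℕ → X → Fin r → Vec r := fun ℓ x =>
    Nat.casesOn ℓ (fun i => EuclideanSpace.single i 1) fun ℓ => b ℓ x
  have hlam : ∀ ℓ x, LinearIndependent ℝ (lam ℓ x) := by
    rintro (_ | ℓ) x
    · have h : lam 0 x = EuclideanSpace.basisFun (Fin r) ℝ := by
        funext i
        simp [lam]
      rw [h]
      exact (EuclideanSpace.basisFun (Fin r) ℝ).orthonormal.linearIndependent
    · exact hbi ℓ x
  choose c hc using fun (ℓ : ℕ) (x : X) => exists_eq_sum_smul (hlam ℓ x)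
  choose w hw using fun x : X => exists_dual_family (hlam (2 * r + 1) x)
  exact ⟨{
    lam := lam
    -- The choices are indexed from zero while the levels start at one; the entries at level zero
    -- play no role.
    lamSeq := fun ℓ ν x i => (z (ℓ - 1) x i ν).2
    y := fun ℓ ν x i => (z (ℓ - 1) x i ν).1
    β := fun ℓ ν x i => c (ℓ - 1) (z (ℓ - 1) x i ν).1 (z (ℓ - 1) x i ν).2
    w := w }, {
    lam_zero := fun _ _ => rfl
    lam_basis := fun ℓ _ x => hbi ℓ x
    lam_mem_orthogonal := fun ℓ _ x i hi => by
      rw [glaeserIter_succ, ← span_limits_eq_glaeser_orthogonal]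
      exact Submodule.subset_span (hblt ℓ x i hi)
    lam_mem := fun ℓ _ x i hi => hbge ℓ x i hi
    y_tendsto := fun ℓ _ x i => hzx ℓ x i
    lamSeq_tendsto := fun ℓ _ x i hi => hzb ℓ x i hi
    lamSeq_orthogonal := fun ℓ _ ν x i => hzo ℓ x i ν
    y_eq := fun ℓ _ ν x i hi => congrArg Prod.fst (hzc ℓ x i hi ν)
    lamSeq_eq := fun ℓ _ ν x i hi => congrArg Prod.snd (hzc ℓ x i hi ν)
    lamSeq_expand := fun ℓ _ ν x i => hc ℓ _ _
    w_dual := hw }⟩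

end LimitData

/-! ### Compactness of the cube -/

section Cube

theorem isCompact_closedCube {n : ℕ} (a : EuclideanSpace ℝ (Fin n)) (δ : ℝ) :
    IsCompact (closedCube a δ) := by
  have h : closedCube a δ = (EuclideanSpace.equiv (Fin n) ℝ) ⁻¹'
      Set.pi Set.univ fun k => Set.Icc (a k) (a k + δ) := by
    ext x
    simp only [closedCube, Set.mem_ofPred_eq, Set.mem_preimage, Set.mem_univ_pi, Set.mem_Icc]
    rfl
  rw [h]
  exact (EuclideanSpace.equiv (Fin n) ℝ).toHomeomorph.isCompact_preimage.2
    (isCompact_univ_pi fun k => isCompact_Icc)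

end Cube

end GlaeserProcedure

/-! ### The main theorem -/

open GlaeserProcedure in
theorem theorem3 (n r : ℕ) (hn : 0 < n) (hr : 0 < r) :
    ∃ (d : ℕ) (C : ℝ), ∀ (a : EuclideanSpace ℝ (Fin n)) (δ : ℝ), 0 < δ →
      ∀ f : Fin r → closedCube a δ → ℝ,
        (∃ D : LimitData (closedCube a δ) r, D.IsAdmissible (kernelBundle f)) ∧
        ∃ (S : closedCube a δ → Finset (closedCube a δ))
          (A : closedCube a δ → closedCube a δ → Vec r →ₗ[ℝ] Vec r),
          (∀ x, (S x).card ≤ d) ∧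
          ∀ D : LimitData (closedCube a δ) r, D.IsAdmissible (kernelBundle f) →
            ∀ (φ : closedCube a δ → ℝ) (φs : Fin r → closedCube a δ → ℝ),
              (∀ i, Continuous (φs i)) → (∀ x, ∑ i, φs i x * f i x = φ x) →
                Succeeds f D φ ∧
                (∀ i, Continuous (output f D S A φ i)) ∧
                (∀ x, ∑ i, output f D S A φ i x * f i x = φ x) ∧
                (⨆ p : closedCube a δ × Fin r, |output f D S A φ p.2 p.1|) ≤
                  C * ⨆ p : closedCube a δ × Fin r, |φs p.2 p.1| := by
  -- Fibers have dimension at most `r`, so `k = r + 1` covers the whole cube. In the constant below,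
  -- one factor `r + 1` is this `k` and the other passes from the maximum of components to the
  -- Euclidean norm.
  obtain ⟨d, hd⟩ := exists_selection_finrank_lt n r (r + 1)
  refine ⟨d, (r + 1) * (r + 1), fun a δ _ f => ⟨exists_isAdmissible _, ?_⟩⟩
  set H := glaeserIter (kernelBundle f) (2 * r + 1) with hH
  obtain ⟨T, hTd, hT⟩ := hd (closedCube a δ) H (glaeser_glaeserIter_eq _)
  choose S hS A hA using hTd
  refine ⟨S, A, hS, fun D hD φ φs hφs hφ => ?_⟩
  let F : closedCube a δ → Vec r := fun x => WithLp.toLp 2 fun i => φs i x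
  have hF : Continuous F := (PiLp.continuous_toLp 2 _).comp (continuous_pi hφs)
  obtain ⟨hTc, hTm⟩ := hT F hF _ fun x => sum_xi_smul_w hD hF hφ x
  have hout : ∀ i x, output f D S A φ i x =
      T (fun y => ∑ j, xi f D φ (2 * r + 1) y j • D.w y j) x i := fun i x => by
    rw [output_eq]
    exact congrArg (fun v : Vec r => v i) (hA x _).symm
  have hrank : ∀ x, Module.finrank ℝ (H x) < r + 1 := fun x =>
    Nat.lt_succ_of_le ((Submodule.finrank_le _).trans_eq finrank_euclideanSpace_fin)
  have : CompactSpace (closedCube a δ) := isCompact_iff_compactSpace.1 (isCompact_closedCube a δ)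
  refine ⟨succeeds_of_continuous hD hF hφ, fun i => ?_, fun x => ?_, ?_⟩
  · have huniv : {x | Module.finrank ℝ (H x) < r + 1} = Set.univ := Set.eq_univ_of_forall hrank
    rw [huniv, continuousOn_univ] at hTc
    simp only [funext (hout i)]
    fun_prop
  · have hmem := glaeserIter_antitone (kernelBundle f) x (Nat.zero_le (2 * r + 1))
      (hTm x (hrank x)).1
    have hmem' : ∑ i, (T (fun y => ∑ j, xi f D φ (2 * r + 1) y j • D.w y j) x - F x) i * f i x =
        0 := hmem
    simp only [PiLp.sub_apply, sub_mul, Finset.sum_sub_distrib, sub_eq_zero] at hmem'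
    simp only [hout]
    rw [hmem', ← hφ]
  · have hbdd : BddAbove (Set.range fun p : closedCube a δ × Fin r => |φs p.2 p.1|) := by
      refine (isCompact_range ?_).bddAbove
      refine continuous_abs.comp ?_
      exact continuous_prod_of_discrete_right.2 fun i => hφs i
    set M := ⨆ p : closedCube a δ × Fin r, |φs p.2 p.1| with hM
    have hM0 : 0 ≤ M := Real.iSup_nonneg fun _ => abs_nonneg _
    refine Real.iSup_le (fun p => ?_) (by positivity)
    rw [hout, ← Real.norm_eq_abs]
    refine (PiLp.norm_apply_le _ _).trans ?_
    refine ((hTm p.1 (hrank p.1)).2 ((r + 1) * M) (by positivity) fun y => ?_).trans_eq ?_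
    · exact norm_le_of_forall_abs_le hM0 fun i => le_ciSup hbdd (y, i)
    · push_cast
      ring
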